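/- Let $d\ge 1$, and let $\varphi\in C^\infty(\mathbb R^d;[0,1])$ be supported in $\{\tfrac34\le|\xi|\le\tfrac83\}$ with $\sum_{j\in\mathbb Z}\varphi(2^{-j}\xi)=1$ for all $\xi\ne0$. Put $\dot\Delta_j=\varphi(2^{-j}D)$, where $m(D)$, $D=-i\nabla$, is the Fourier multiplier with symbol $m$. For $s\in\mathbb R$ and $1\le p,q\le\infty$, the homogeneous Besov space $\dot B^{s}_{p,q}(\mathbb R^d)$ consists of the tempered distributions $u\in\mathcal S'_h$ (that is, $\|\theta(\lambda D)u\|_{L^\infty}\to0$ as $\lambda\to\infty$ for every $\theta\in C_c^\infty(\mathbb R^d)$) with $$\|u\|_{\dot B^{s}_{p,q}}=\Big\|\big(2^{js}\|\dot\Delta_ju\|_{L^p}\big)_{j\in\mathbb Z}\Big\|_{\ell^q(\mathbb Z)}<\infty .$$ Let $1\le p\le\infty$ and $1<q\le\infty$, with the conventions $\tfrac d\infty=0$ and $\tfrac1\infty=0$. (i) For every $\alpha$ with $\tfrac1q<\alpha<1$ there are constants $C,c>0$ and $N_0$ (with $\ln\ln N_0>0$), depending only on $d,p,q,\alpha,\varphi$,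 and complex-valued Schwartz functions $f^N,g^N$ on $\mathbb R^d$ such that for all integers $N\ge N_0$ the functions $f^N$, $g^N$ and $f^Ng^N$ belong to $\dot B^{d/p}_{p,q}$, $$\|f^N\|_{\dot B^{d/p}_{p,q}}+\|g^N\|_{\dot B^{d/p}_{p,q}}\le C(\ln\ln N)^{-1} \quad\text{and}\quad \|f^Ng^N\|_{\dot B^{d/p}_{p,q}}\ge c\,N^{1-\alpha}(\ln\ln N)^{-1}.$$ In particular, as $N\to\infty$, $\|f^N\|_{\dot B^{d/p}_{p,q}}+\|g^N\|_{\dot B^{d/p}_{p,q}}\to0$ while $\|f^Ng^N\|_{\dot B^{d/p}_{p,q}}\to\infty$. (ii) Consequently $\dot B^{d/p}_{p,q}$ is not an algebra: for every constant $C$ there are Schwartz functions $f,g$ with $f,g,fg\in\dot B^{d/p}_{p,q}$ and $$\|fg\|_{\dot B^{d/p}_{p,q}}>C\,\|f\|_{\dot B^{d/p}_{p,q}}\|g\|_{\dot B^{d/p}_{p,q}}.$$ -/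

import Mathlib

open MeasureTheory Filter Topology
open scoped ENNReal SchwartzMap ContDiff

/-- `φ` generates a homogeneous Littlewood-Paley decomposition of `ℝ^d`: it is smooth with values in
`[0, 1]`, is supported in the annulus `3/4 ≤ |ξ| ≤ 8/3`, and `∑_{j ∈ ℤ} φ(2^{-j} ξ) = 1` for all
`ξ ≠ 0`. -/
structure IsLittlewoodPaley {d : ℕ} (φ : EuclideanSpace ℝ (Fin d) → ℝ) : Prop where
  contDiff : ContDiff ℝ ∞ φ
  mem_Icc : ∀ ξ, φ ξ ∈ Set.Icc (0 : ℝ) 1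
  tsupport_subset : tsupport φ ⊆ {ξ | 3 / 4 ≤ ‖ξ‖ ∧ ‖ξ‖ ≤ 8 / 3}
  hasSum : ∀ ξ, ξ ≠ 0 → HasSum (fun j : ℤ => φ ((2 : ℝ) ^ (-j) • ξ)) 1

noncomputable section

/-- The Fourier multiplier `m(D)`, `D = -i∇`, on tempered distributions. Mathlib's Fourier transform
has the kernel `e^{-2πi x·ξ}`, in which `D` has the symbol `2πξ`. -/
def multiplierD {d : ℕ} (m : EuclideanSpace ℝ (Fin d) → ℝ) (u : 𝓢'(EuclideanSpace ℝ (Fin d), ℂ)) :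
    𝓢'(EuclideanSpace ℝ (Fin d), ℂ) :=
  TemperedDistribution.fourierMultiplierCLM ℂ (fun ξ => (m ((2 * Real.pi) • ξ) : ℂ)) u

/-- The homogeneous dyadic block `Δ̇_j u = φ(2^{-j} D) u`. -/
def dyadicBlock {d : ℕ} (φ : EuclideanSpace ℝ (Fin d) → ℝ) (j : ℤ)
    (u : 𝓢'(EuclideanSpace ℝ (Fin d), ℂ)) : 𝓢'(EuclideanSpace ℝ (Fin d), ℂ) :=
  multiplierD (fun ξ => φ ((2 : ℝ) ^ (-j) • ξ)) u

/-- The `L^p` norm of a tempered distribution: the norm of the (unique) `L^p` function that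
represents it, and `∞` if there is none. -/
def distribLpNorm {d : ℕ} (p : ℝ≥0∞) [Fact (1 ≤ p)] (u : 𝓢'(EuclideanSpace ℝ (Fin d), ℂ)) : ℝ≥0∞ :=
  ⨅ (f : Lp ℂ p (volume : Measure (EuclideanSpace ℝ (Fin d))))
    (_ : Lp.toTemperedDistribution f = u), ‖f‖ₑ

/-- The space `𝓢'_h`: tempered distributions `u` with `‖θ(λD) u‖_{L^∞} → 0` as `λ → ∞` for every
test function `θ`. -/
def IsSh {d : ℕ} (u : 𝓢'(EuclideanSpace ℝ (Fin d), ℂ)) : Prop :=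
  ∀ θ : EuclideanSpace ℝ (Fin d) → ℝ, ContDiff ℝ ∞ θ → HasCompactSupport θ →
    Tendsto (fun r : ℝ => distribLpNorm (⊤ : ℝ≥0∞) (multiplierD (fun ξ => θ (r • ξ)) u)) atTop (𝓝 0)

/-- The extended norm `‖ (2^{js} ‖Δ̇_j u‖_{L^p})_{j ∈ ℤ} ‖_{ℓ^q(ℤ)}` of `Ḃ^s_{p,q}`. The `ℓ^q` norm
is the `L^q` norm with respect to the counting measure on `ℤ`. -/
def besovNorm {d : ℕ} (φ : EuclideanSpace ℝ (Fin d) → ℝ) (s : ℝ) (p q : ℝ≥0∞) [Fact (1 ≤ p)]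
    (u : 𝓢'(EuclideanSpace ℝ (Fin d), ℂ)) : ℝ≥0∞ :=
  eLpNorm (fun j : ℤ => ENNReal.ofReal ((2 : ℝ) ^ ((j : ℝ) * s)) *
    distribLpNorm p (dyadicBlock φ j u)) q Measure.count

/-- Membership in the homogeneous Besov space `Ḃ^s_{p,q}`. -/
def MemBesov {d : ℕ} (φ : EuclideanSpace ℝ (Fin d) → ℝ) (s : ℝ) (p q : ℝ≥0∞) [Fact (1 ≤ p)]
    (u : 𝓢'(EuclideanSpace ℝ (Fin d), ℂ)) : Prop :=
  IsSh u ∧ besovNorm φ s p q u < ⊤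

/-- The critical exponent `d / p`, equal to `0` for `p = ∞`. -/
def critExp (d : ℕ) (p : ℝ≥0∞) : ℝ := d * (p⁻¹).toReal

/-- The pointwise product of two Schwartz functions. -/
def schwartzMul {d : ℕ} (f g : 𝓢(EuclideanSpace ℝ (Fin d), ℂ)) : 𝓢(EuclideanSpace ℝ (Fin d), ℂ) :=
  SchwartzMap.pairing (ContinuousLinearMap.mul ℂ ℂ) f g

end

/-! `Ḃ^{d/p}_{p,q}` is scale invariant, and for `q > 1` its norm does not control values at a point.
Let `h` be the convolution kernel of `Δ̇_0`. Its transform is `φ(2π ·) ≥ 0`, so `h 0 = ∫ φ(2π ξ) dξ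
> 0`. The dilates `h(2^j ·)`, `0 ≤ j < N`, all take this value at the origin, so their sum there is
`N * h 0`. Each dyadic block meets at most three of them, so the Besov norm of the sum is only
`O(N^{1/q})` (`besovNorm_sum_dyadicDilation_le`). With `f = N^{-α} ∑ h(2^j ·)`, the norm is
`O(N^{1/q-α})`, while `f 0` is of size `N^{1-α}`.

A product detects this point value. Let `g = (ln ln N)⁻¹ h(2^M ·)` with `M` so large that `f` is
nearly constant at scale `2^{-M}`. After rescaling, `Δ̇_M (f g)` is close to `(ln ln N)⁻¹ f 0 * Δ̇_0
h`. Pairing with a fixed Schwartz function turns this into a lower bound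
(`exists_le_besovNorm_schwartzMul`). The condition `α > 1/q` makes `f` small and `α < 1` makes the
product blow up; `q > 1` leaves room for both. -/

open FourierTransform

/-! ### Fourier multipliers and dyadic blocks on Schwartz functions -/

section Multiplier

variable {d : ℕ}

/-- The symbol of the Fourier multiplier `m(D)` in Mathlib's normalization has temperate growth
when `m` is a test function. -/
theorem hasTemperateGrowth_symbol {m : EuclideanSpace ℝ (Fin d) → ℝ} (hm : ContDiff ℝ ∞ m)
    (hc : HasCompactSupport m) {r : ℝ} (hr : r ≠ 0) :
    Function.HasTemperateGrowth
      (fun ξ : EuclideanSpace ℝ (Fin d) => (m (r • (2 * Real.pi) • ξ) : ℂ)) := by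
  have h1 : HasCompactSupport (fun ξ : EuclideanSpace ℝ (Fin d) => m (r • (2 * Real.pi) • ξ)) := by
    have := hc.comp_smul (c := r * (2 * Real.pi)) (by positivity)
    simpa [mul_smul] using this
  have h2 : HasCompactSupport
      (fun ξ : EuclideanSpace ℝ (Fin d) => (m (r • (2 * Real.pi) • ξ) : ℂ)) :=
    h1.comp_left (g := Complex.ofReal) rfl
  refine h2.hasTemperateGrowth ?_
  exact Complex.ofRealCLM.contDiff.comp (hm.comp (by fun_prop))

theorem IsLittlewoodPaley.hasCompactSupport {φ : EuclideanSpace ℝ (Fin d) → ℝ}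
    (hφ : IsLittlewoodPaley φ) : HasCompactSupport φ := by
  refine HasCompactSupport.of_support_subset_isCompact
    (isCompact_closedBall (0 : EuclideanSpace ℝ (Fin d)) (8 / 3)) ?_
  intro ξ hξ
  have := hφ.tsupport_subset (subset_tsupport _ hξ)
  simpa using this.2

theorem IsLittlewoodPaley.norm_mem {φ : EuclideanSpace ℝ (Fin d) → ℝ}
    (hφ : IsLittlewoodPaley φ) {ξ : EuclideanSpace ℝ (Fin d)} (h : φ ξ ≠ 0) :
    3 / 4 ≤ ‖ξ‖ ∧ ‖ξ‖ ≤ 8 / 3 :=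
  hφ.tsupport_subset (subset_tsupport _ h)

/-- A Fourier multiplier on Schwartz functions whose symbol is a dilated test function. -/
noncomputable def schwartzMultiplier (m : EuclideanSpace ℝ (Fin d) → ℝ) (r : ℝ) :
    𝓢(EuclideanSpace ℝ (Fin d), ℂ) →L[ℂ] 𝓢(EuclideanSpace ℝ (Fin d), ℂ) :=
  SchwartzMap.fourierMultiplierCLM ℂ (fun ξ => (m (r • (2 * Real.pi) • ξ) : ℂ))

theorem fourier_schwartzMultiplier {m : EuclideanSpace ℝ (Fin d) → ℝ} (hm : ContDiff ℝ ∞ m)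
    (hc : HasCompactSupport m) {r : ℝ} (hr : r ≠ 0) (u : 𝓢(EuclideanSpace ℝ (Fin d), ℂ))
    (ξ : EuclideanSpace ℝ (Fin d)) :
    𝓕 (schwartzMultiplier m r u) ξ = (m (r • (2 * Real.pi) • ξ) : ℂ) * 𝓕 u ξ := by
  simp [schwartzMultiplier, SchwartzMap.fourierMultiplierCLM_apply,
    SchwartzMap.smulLeftCLM_apply_apply (hasTemperateGrowth_symbol hm hc hr)]

theorem multiplierD_coe {m : EuclideanSpace ℝ (Fin d) → ℝ} (hm : ContDiff ℝ ∞ m)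
    (hc : HasCompactSupport m) {r : ℝ} (hr : r ≠ 0) (u : 𝓢(EuclideanSpace ℝ (Fin d), ℂ)) :
    multiplierD (fun ξ => m (r • ξ)) (u : 𝓢'(EuclideanSpace ℝ (Fin d), ℂ)) =
      schwartzMultiplier m r u :=
  TemperedDistribution.fourierMultiplierCLM_toTemperedDistributionCLM_eq
    (hasTemperateGrowth_symbol hm hc hr) u

/-- The homogeneous dyadic block of a Schwartz function. -/
noncomputable def schwartzBlock (φ : EuclideanSpace ℝ (Fin d) → ℝ) (k : ℤ) :
    𝓢(EuclideanSpace ℝ (Fin d), ℂ) →L[ℂ] 𝓢(EuclideanSpace ℝ (Fin d), ℂ) :=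
  schwartzMultiplier φ ((2 : ℝ) ^ (-k))

theorem IsLittlewoodPaley.fourier_schwartzBlock {φ : EuclideanSpace ℝ (Fin d) → ℝ}
    (hφ : IsLittlewoodPaley φ) (k : ℤ) (u : 𝓢(EuclideanSpace ℝ (Fin d), ℂ))
    (ξ : EuclideanSpace ℝ (Fin d)) :
    𝓕 (schwartzBlock φ k u) ξ = (φ ((2 : ℝ) ^ (-k) • (2 * Real.pi) • ξ) : ℂ) * 𝓕 u ξ :=
  fourier_schwartzMultiplier hφ.contDiff hφ.hasCompactSupport (by positivity) u ξ

theorem IsLittlewoodPaley.dyadicBlock_coe {φ : EuclideanSpace ℝ (Fin d) → ℝ}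
    (hφ : IsLittlewoodPaley φ) (k : ℤ) (u : 𝓢(EuclideanSpace ℝ (Fin d), ℂ)) :
    dyadicBlock φ k (u : 𝓢'(EuclideanSpace ℝ (Fin d), ℂ)) = schwartzBlock φ k u :=
  multiplierD_coe hφ.contDiff hφ.hasCompactSupport (by positivity) u

theorem schwartz_ext_fourier {u v : 𝓢(EuclideanSpace ℝ (Fin d), ℂ)}
    (h : ∀ ξ, 𝓕 u ξ = 𝓕 v ξ) : u = v :=
  (FourierTransform.fourierEquiv ℂ 𝓢(EuclideanSpace ℝ (Fin d), ℂ)).injective (SchwartzMap.ext h)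

/-- On Schwartz functions `distribLpNorm` is the usual `L^p` norm. -/
theorem distribLpNorm_coe (p : ℝ≥0∞) [Fact (1 ≤ p)] (u : 𝓢(EuclideanSpace ℝ (Fin d), ℂ)) :
    distribLpNorm p (u : 𝓢'(EuclideanSpace ℝ (Fin d), ℂ)) = eLpNorm u p volume := by
  have hu : Lp.toTemperedDistribution (u.toLp p volume) =
      (u : 𝓢'(EuclideanSpace ℝ (Fin d), ℂ)) := Lp.toTemperedDistribution_toLp_eq u
  have hn : ‖u.toLp p volume‖ₑ = eLpNorm u p volume := by
    rw [Lp.enorm_def]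
    exact eLpNorm_congr_ae (u.coeFn_toLp p volume)
  rw [← hn]
  refine le_antisymm (iInf₂_le (u.toLp p volume) hu) (le_iInf₂ fun f hf => ?_)
  have hinj : Function.Injective (Lp.toTemperedDistributionCLM ℂ
      (volume : Measure (EuclideanSpace ℝ (Fin d))) p) :=
    LinearMap.ker_eq_bot.mp (Lp.ker_toTemperedDistributionCLM_eq_bot (F := ℂ)
      (μ := (volume : Measure (EuclideanSpace ℝ (Fin d)))) (p := p))
  rw [hinj (hf.trans hu.symm)]

end Multiplier

/-! ### Dyadic dilations, and spectra of products -/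

section Dilation

variable {d : ℕ}

/-- The dyadic dilation `u ↦ u(2^k ·)` of Schwartz functions. -/
noncomputable def dyadicDilation (k : ℤ) :
    𝓢(EuclideanSpace ℝ (Fin d), ℂ) →L[ℂ] 𝓢(EuclideanSpace ℝ (Fin d), ℂ) :=
  SchwartzMap.compCLMOfContinuousLinearEquiv ℂ
    (ContinuousLinearEquiv.smulLeft (Units.mk0 ((2 : ℝ) ^ k) (by positivity)))

theorem dyadicDilation_apply (k : ℤ) (u : 𝓢(EuclideanSpace ℝ (Fin d), ℂ))
    (x : EuclideanSpace ℝ (Fin d)) : dyadicDilation k u x = u ((2 : ℝ) ^ k • x) := rfl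

theorem dyadicDilation_dyadicDilation (j k : ℤ) (u : 𝓢(EuclideanSpace ℝ (Fin d), ℂ)) :
    dyadicDilation j (dyadicDilation k u) = dyadicDilation (j + k) u := by
  ext x
  simp only [dyadicDilation_apply, smul_smul]
  rw [← zpow_add₀ two_ne_zero, add_comm]

theorem fourier_dyadicDilation (k : ℤ) (u : 𝓢(EuclideanSpace ℝ (Fin d), ℂ))
    (ξ : EuclideanSpace ℝ (Fin d)) :
    𝓕 (dyadicDilation k u) ξ = ((((2 : ℝ) ^ k) ^ d)⁻¹ : ℝ) * 𝓕 u ((2 : ℝ) ^ (-k) • ξ) := by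
  rw [SchwartzMap.fourier_coe, SchwartzMap.fourier_coe, Real.fourier_eq, Real.fourier_eq]
  have := Measure.integral_comp_smul (volume : Measure (EuclideanSpace ℝ (Fin d)))
    (fun v => Real.fourierChar (-inner ℝ v ((2 : ℝ) ^ (-k) • ξ)) • u v) ((2 : ℝ) ^ k)
  rw [finrank_euclideanSpace_fin, abs_of_pos (by positivity)] at this
  rw [← Complex.real_smul, ← this]
  congr 1
  ext v
  have h2 : ((2 : ℝ) ^ k)⁻¹ * ((2 : ℝ) ^ k * inner ℝ v ξ) = inner ℝ v ξ := by
    rw [← mul_assoc, inv_mul_cancel₀ (by positivity), one_mul]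
  simp [dyadicDilation_apply, inner_smul_left, inner_smul_right, h2]

/-- This factor is exactly inverse to the Besov weight `2^{ks}` at `s = d/p`, the source of scale
invariance. -/
theorem eLpNorm_dyadicDilation (k : ℤ) (p : ℝ≥0∞) (u : 𝓢(EuclideanSpace ℝ (Fin d), ℂ)) :
    eLpNorm (dyadicDilation k u) p volume =
      ENNReal.ofReal ((2 : ℝ) ^ (-(k : ℝ) * critExp d p)) * eLpNorm u p volume := by
  have h1 := Measure.map_addHaar_smul (volume : Measure (EuclideanSpace ℝ (Fin d)))
    (r := (2 : ℝ) ^ k) (by positivity)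
  have h2 := eLpNorm_map_measure (p := p) (μ := volume)
    (f := fun x : EuclideanSpace ℝ (Fin d) => (2 : ℝ) ^ k • x) (g := u)
    u.continuous.aestronglyMeasurable (by fun_prop)
  rw [h1, finrank_euclideanSpace_fin, abs_of_pos (by positivity),
    eLpNorm_smul_measure_of_ne_zero (by simp; positivity)] at h2
  change eLpNorm (u ∘ fun x => (2 : ℝ) ^ k • x) p volume = _
  rw [← h2, smul_eq_mul, ENNReal.ofReal_rpow_of_pos (by positivity)]
  congr 2
  rw [critExp, one_div, ← Real.rpow_intCast, ← Real.rpow_natCast, ← Real.rpow_mul (by norm_num),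
    ← Real.rpow_neg (by norm_num), ← Real.rpow_mul (by norm_num)]
  ring_nf

theorem IsLittlewoodPaley.schwartzBlock_dyadicDilation {φ : EuclideanSpace ℝ (Fin d) → ℝ}
    (hφ : IsLittlewoodPaley φ) (j k : ℤ) (u : 𝓢(EuclideanSpace ℝ (Fin d), ℂ)) :
    schwartzBlock φ k (dyadicDilation j u) = dyadicDilation j (schwartzBlock φ (k - j) u) := by
  refine schwartz_ext_fourier fun ξ => ?_
  rw [hφ.fourier_schwartzBlock, fourier_dyadicDilation, fourier_dyadicDilation,
    hφ.fourier_schwartzBlock, smul_comm (2 * Real.pi) ((2 : ℝ) ^ (-j)) ξ, smul_smul _ _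
    ((2 * Real.pi) • ξ), ← zpow_add₀ (two_ne_zero (α := ℝ))]
  rw [show -(k - j) + -j = -k by ring]
  ring

theorem schwartzMul_smul (c : ℂ) (u v : 𝓢(EuclideanSpace ℝ (Fin d), ℂ)) :
    schwartzMul u (c • v) = schwartzMul (c • u) v := by
  simp [schwartzMul]

theorem schwartzMul_apply (u v : 𝓢(EuclideanSpace ℝ (Fin d), ℂ)) (x : EuclideanSpace ℝ (Fin d)) :
    schwartzMul u v x = u x * v x := by
  simp [schwartzMul]

theorem dyadicDilation_schwartzMul (k : ℤ) (u v : 𝓢(EuclideanSpace ℝ (Fin d), ℂ)) :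
    dyadicDilation k (schwartzMul u v) =
      schwartzMul (dyadicDilation k u) (dyadicDilation k v) := by
  ext x
  simp [dyadicDilation_apply, schwartzMul_apply]

/-- If `𝓕 u` lives in the ball of radius `b` and `𝓕 v` in the annulus `[a', b']`, then
`𝓕 (u v)` lives in the annulus `[a' - b, b' + b]`. -/
theorem fourier_schwartzMul_support {u v : 𝓢(EuclideanSpace ℝ (Fin d), ℂ)} {b a' b' : ℝ}
    (hu : ∀ ξ, 𝓕 u ξ ≠ 0 → ‖ξ‖ ≤ b) (hv : ∀ ξ, 𝓕 v ξ ≠ 0 → a' ≤ ‖ξ‖ ∧ ‖ξ‖ ≤ b')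
    (ξ : EuclideanSpace ℝ (Fin d)) (h : 𝓕 (schwartzMul u v) ξ ≠ 0) :
    a' - b ≤ ‖ξ‖ ∧ ‖ξ‖ ≤ b' + b := by
  have hinv : ∀ (w : 𝓢(EuclideanSpace ℝ (Fin d), ℂ)) η, 𝓕⁻ w η = 𝓕 w (-η) := fun w η => by
    rw [SchwartzMap.fourierInv_apply_eq]; rfl
  -- The transform turns convolutions into products; applied to `𝓕⁻ u` and `𝓕⁻ v`, this expresses
  -- the transform of `u v` as a convolution.
  have h1 : 𝓕⁻ (schwartzMul u v) =
      SchwartzMap.convolution (ContinuousLinearMap.mul ℂ ℂ) (𝓕⁻ u) (𝓕⁻ v) := by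
    have := SchwartzMap.fourier_convolution (ContinuousLinearMap.mul ℂ ℂ) (𝓕⁻ u) (𝓕⁻ v)
    rw [FourierTransform.fourier_fourierInv_eq, FourierTransform.fourier_fourierInv_eq] at this
    rw [schwartzMul, ← this, FourierTransform.fourierInv_fourier_eq]
  have h2 : 𝓕 (schwartzMul u v) ξ = ∫ t, 𝓕 u (-t) * 𝓕 v (-(-ξ - t)) := by
    rw [← neg_neg ξ, ← hinv, h1, SchwartzMap.convolution_apply, convolution_def]
    simp [hinv]
  obtain ⟨t, ht⟩ : ∃ t, 𝓕 u (-t) * 𝓕 v (-(-ξ - t)) ≠ 0 := by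
    by_contra! hcon
    exact h (by rw [h2]; simp only [hcon, integral_zero])
  have hut := hu _ (left_ne_zero_of_mul ht)
  obtain ⟨hv1, hv2⟩ := hv _ (right_ne_zero_of_mul ht)
  have e : -(-ξ - t) = ξ + t := by abel
  rw [e] at hv1 hv2
  rw [norm_neg] at hut
  constructor
  · linarith [norm_add_le ξ t]
  · have : ‖ξ‖ ≤ ‖ξ + t‖ + ‖t‖ := by simpa using norm_sub_le (ξ + t) t
    linarith

end Dilation

/-! ### Besov norms of Schwartz functions -/

section Besov

variable {d : ℕ} {φ : EuclideanSpace ℝ (Fin d) → ℝ}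

theorem IsLittlewoodPaley.besovNorm_coe (hφ : IsLittlewoodPaley φ) (s : ℝ) (p q : ℝ≥0∞)
    [Fact (1 ≤ p)] (u : 𝓢(EuclideanSpace ℝ (Fin d), ℂ)) :
    besovNorm φ s p q (u : 𝓢'(EuclideanSpace ℝ (Fin d), ℂ)) =
      eLpNorm (fun k : ℤ => ENNReal.ofReal ((2 : ℝ) ^ ((k : ℝ) * s)) *
        eLpNorm (schwartzBlock φ k u) p volume) q Measure.count := by
  simp only [besovNorm, hφ.dyadicBlock_coe, distribLpNorm_coe]

theorem IsLittlewoodPaley.besovNorm_le (hφ : IsLittlewoodPaley φ) {s : ℝ} {p q : ℝ≥0∞}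
    [Fact (1 ≤ p)] {u : 𝓢(EuclideanSpace ℝ (Fin d), ℂ)} {S : Finset ℤ} {B : ℝ≥0∞}
    (h0 : ∀ k ∉ S, schwartzBlock φ k u = 0)
    (hB : ∀ k ∈ S, ENNReal.ofReal ((2 : ℝ) ^ ((k : ℝ) * s)) *
      eLpNorm (schwartzBlock φ k u) p volume ≤ B) :
    besovNorm φ s p q (u : 𝓢'(EuclideanSpace ℝ (Fin d), ℂ)) ≤ B * (S.card : ℝ≥0∞) ^ (q⁻¹).toReal := by
  rw [hφ.besovNorm_coe]
  refine (eLpNorm_mono_enorm (g := (S : Set ℤ).indicator fun _ => B) fun k => ?_).trans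
    ((eLpNorm_indicator_const_le B q).trans ?_)
  · by_cases hk : k ∈ S
    · simpa [hk] using hB k hk
    · have hz : eLpNorm (0 : EuclideanSpace ℝ (Fin d) → ℂ) p volume = 0 := eLpNorm_zero
      simp [hk, h0 k hk]
  · simp

theorem IsLittlewoodPaley.le_besovNorm (hφ : IsLittlewoodPaley φ) (s : ℝ) (p : ℝ≥0∞) {q : ℝ≥0∞}
    [Fact (1 ≤ p)] (hq : q ≠ 0) (u : 𝓢(EuclideanSpace ℝ (Fin d), ℂ)) (k : ℤ) :
    ENNReal.ofReal ((2 : ℝ) ^ ((k : ℝ) * s)) * eLpNorm (schwartzBlock φ k u) p volume ≤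
      besovNorm φ s p q (u : 𝓢'(EuclideanSpace ℝ (Fin d), ℂ)) := by
  rw [hφ.besovNorm_coe]
  exact enorm_le_eLpNorm_count (fun k : ℤ => ENNReal.ofReal ((2 : ℝ) ^ ((k : ℝ) * s)) *
    eLpNorm (schwartzBlock φ k u) p volume) k hq

theorem IsLittlewoodPaley.exists_schwartzBlock_eq_zero (hφ : IsLittlewoodPaley φ)
    {u : 𝓢(EuclideanSpace ℝ (Fin d), ℂ)} {a b : ℝ} (ha : 0 < a)
    (hu : ∀ ξ, 𝓕 u ξ ≠ 0 → a ≤ ‖ξ‖ ∧ ‖ξ‖ ≤ b) :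
    ∃ S : Finset ℤ, ∀ k ∉ S, schwartzBlock φ k u = 0 := by
  -- If block `k` meets the annulus, then `2π a * 3/8 ≤ 2^k ≤ 2π b * 4/3`; `n` is chosen to place
  -- both ends strictly between `2^{-n}` and `2^n`.
  obtain ⟨n, hn⟩ := pow_unbounded_of_one_lt (max (2 * Real.pi * b * (4 / 3))
    (2 * Real.pi * a * (3 / 8))⁻¹) (one_lt_two (α := ℝ))
  obtain ⟨hn1, hn2⟩ := max_lt_iff.mp hn
  refine ⟨Finset.Icc (-n) n, fun k hk => schwartz_ext_fourier fun ξ => ?_⟩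
  rw [hφ.fourier_schwartzBlock, FourierTransform.fourier_zero]
  by_contra hne
  rw [zero_apply] at hne
  obtain ⟨h1, h2⟩ := hu ξ (right_ne_zero_of_mul hne)
  obtain ⟨h3, h4⟩ := hφ.norm_mem (ξ := (2 : ℝ) ^ (-k) • (2 * Real.pi) • ξ)
    (by exact_mod_cast left_ne_zero_of_mul hne)
  have hpi := Real.pi_pos
  have h2k : (0 : ℝ) < 2 ^ k := by positivity
  rw [norm_smul, norm_smul, Real.norm_of_nonneg (by positivity), Real.norm_of_nonneg (by positivity),
    zpow_neg, inv_mul_eq_div] at h3 h4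
  rw [le_div_iff₀ h2k] at h3
  rw [div_le_iff₀ h2k] at h4
  have hlow : (2 : ℝ) ^ (-n : ℤ) < 2 ^ k := by
    rw [zpow_neg, zpow_natCast]
    refine (inv_lt_of_inv_lt₀ (by positivity) hn2).trans_le ?_
    nlinarith [mul_le_mul_of_nonneg_left h1 (by positivity : 0 ≤ 2 * Real.pi)]
  have hhigh : (2 : ℝ) ^ k < 2 ^ (n : ℤ) := by
    rw [zpow_natCast]
    refine lt_of_le_of_lt ?_ hn1
    nlinarith [mul_le_mul_of_nonneg_left h2 (by positivity : 0 ≤ 2 * Real.pi)]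
  rw [zpow_lt_zpow_iff_right₀ one_lt_two] at hlow hhigh
  exact hk (Finset.mem_Icc.mpr ⟨hlow.le, hhigh.le⟩)

/-- The transform of `u` vanishes near the origin, so `θ(rD) u` is exactly zero once the shrinking
support of `θ(r ·)` fits in that gap. -/
theorem isSh_of_fourier_support {u : 𝓢(EuclideanSpace ℝ (Fin d), ℂ)} {a : ℝ} (ha : 0 < a)
    (hu : ∀ ξ, 𝓕 u ξ ≠ 0 → a ≤ ‖ξ‖) : IsSh (u : 𝓢'(EuclideanSpace ℝ (Fin d), ℂ)) := by
  intro θ hθ hc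
  obtain ⟨R, hR⟩ := hc.isCompact.isBounded.exists_norm_le
  refine tendsto_const_nhds.congr' ?_
  filter_upwards [eventually_gt_atTop (0 : ℝ), eventually_gt_atTop (R / (2 * Real.pi * a))]
    with r hr hr2
  rw [multiplierD_coe hθ hc hr.ne', distribLpNorm_coe]
  have hz : schwartzMultiplier θ r u = 0 := schwartz_ext_fourier fun ξ => by
    rw [fourier_schwartzMultiplier hθ hc hr.ne', FourierTransform.fourier_zero]
    by_contra hne
    rw [zero_apply] at hne
    have h1 := hu ξ (right_ne_zero_of_mul hne)
    have h2 := hR (r • (2 * Real.pi) • ξ)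
      (subset_tsupport _ (by exact_mod_cast left_ne_zero_of_mul hne))
    have hpi := Real.pi_pos
    rw [norm_smul, norm_smul, Real.norm_of_nonneg hr.le, Real.norm_of_nonneg (by positivity)] at h2
    rw [div_lt_iff₀ (by positivity)] at hr2
    nlinarith [mul_le_mul_of_nonneg_left h1 (by positivity : 0 ≤ r * (2 * Real.pi))]
  simp [hz]

/-- Schwartz functions with Fourier transform supported in an annulus lie in every homogeneous
Besov space. -/
theorem IsLittlewoodPaley.memBesov (hφ : IsLittlewoodPaley φ) (s : ℝ) (p q : ℝ≥0∞)
    [Fact (1 ≤ p)] {u : 𝓢(EuclideanSpace ℝ (Fin d), ℂ)} {a b : ℝ} (ha : 0 < a)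
    (hu : ∀ ξ, 𝓕 u ξ ≠ 0 → a ≤ ‖ξ‖ ∧ ‖ξ‖ ≤ b) :
    MemBesov φ s p q (u : 𝓢'(EuclideanSpace ℝ (Fin d), ℂ)) := by
  refine ⟨isSh_of_fourier_support ha fun ξ h => (hu ξ h).1, ?_⟩
  obtain ⟨S, hS⟩ := hφ.exists_schwartzBlock_eq_zero ha hu
  refine (hφ.besovNorm_le hS (B := ∑ k ∈ S, ENNReal.ofReal ((2 : ℝ) ^ ((k : ℝ) * s)) *
    eLpNorm (schwartzBlock φ k u) p volume) fun k hk =>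
      Finset.single_le_sum (f := fun k : ℤ => ENNReal.ofReal ((2 : ℝ) ^ ((k : ℝ) * s)) *
        eLpNorm (schwartzBlock φ k u) p volume) (fun _ _ => zero_le) hk).trans_lt ?_
  refine ENNReal.mul_lt_top (ENNReal.sum_lt_top.mpr fun k _ => ENNReal.mul_lt_top
    ENNReal.ofReal_lt_top (SchwartzMap.eLpNorm_lt_top _ _ _)) ?_
  exact ENNReal.rpow_lt_top_of_nonneg ENNReal.toReal_nonneg (by simp)

end Besov

/-! ### The Littlewood-Paley kernel -/

section Kernel

variable {d : ℕ} {φ : EuclideanSpace ℝ (Fin d) → ℝ}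

theorem IsLittlewoodPaley.exists_symbol (hφ : IsLittlewoodPaley φ) :
    ∃ m : 𝓢(EuclideanSpace ℝ (Fin d), ℂ), ∀ ξ, m ξ = (φ ((2 * Real.pi) • ξ) : ℂ) := by
  have h1 : HasCompactSupport (fun ξ : EuclideanSpace ℝ (Fin d) => φ ((2 * Real.pi) • ξ)) :=
    hφ.hasCompactSupport.comp_smul (by positivity)
  have h2 : HasCompactSupport
      (fun ξ : EuclideanSpace ℝ (Fin d) => (φ ((2 * Real.pi) • ξ) : ℂ)) :=
    h1.comp_left (g := Complex.ofReal) rfl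
  have h3 : ContDiff ℝ ∞ (fun ξ : EuclideanSpace ℝ (Fin d) => (φ ((2 * Real.pi) • ξ) : ℂ)) :=
    Complex.ofRealCLM.contDiff.comp (hφ.contDiff.comp (by fun_prop))
  exact ⟨h2.toSchwartzMap h3, fun ξ => rfl⟩

/-- The symbol `φ(2π ·)` of the block `Δ̇_0` as a Schwartz function. -/
noncomputable def IsLittlewoodPaley.symbol (hφ : IsLittlewoodPaley φ) :
    𝓢(EuclideanSpace ℝ (Fin d), ℂ) := hφ.exists_symbol.choose

theorem IsLittlewoodPaley.symbol_apply (hφ : IsLittlewoodPaley φ) (ξ : EuclideanSpace ℝ (Fin d)) :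
    hφ.symbol ξ = (φ ((2 * Real.pi) • ξ) : ℂ) := hφ.exists_symbol.choose_spec ξ

/-- The convolution kernel of the block `Δ̇_0`. -/
noncomputable def IsLittlewoodPaley.kernel (hφ : IsLittlewoodPaley φ) :
    𝓢(EuclideanSpace ℝ (Fin d), ℂ) := 𝓕⁻ hφ.symbol

theorem IsLittlewoodPaley.fourier_kernel (hφ : IsLittlewoodPaley φ) :
    𝓕 hφ.kernel = hφ.symbol := FourierTransform.fourier_fourierInv_eq _

/-- The constants are `3/4` and `8/3` divided by `2π`, because of the normalization of `𝓕`. -/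
theorem IsLittlewoodPaley.fourier_dyadicDilation_kernel_support (hφ : IsLittlewoodPaley φ) (j : ℤ)
    (ξ : EuclideanSpace ℝ (Fin d)) (h : 𝓕 (dyadicDilation j hφ.kernel) ξ ≠ 0) :
    (2 : ℝ) ^ j * (3 / (8 * Real.pi)) ≤ ‖ξ‖ ∧ ‖ξ‖ ≤ (2 : ℝ) ^ j * (4 / (3 * Real.pi)) := by
  rw [fourier_dyadicDilation, hφ.fourier_kernel, hφ.symbol_apply] at h
  obtain ⟨h3, h4⟩ := hφ.norm_mem (by exact_mod_cast right_ne_zero_of_mul h)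
  have hpi := Real.pi_pos
  have h2k : (0 : ℝ) < 2 ^ j := by positivity
  rw [norm_smul, norm_smul, Real.norm_of_nonneg (by positivity), Real.norm_of_nonneg (by positivity),
    zpow_neg, inv_mul_eq_div, mul_div_assoc'] at h3 h4
  rw [le_div_iff₀ h2k] at h3
  rw [div_le_iff₀ h2k] at h4
  constructor
  · rw [mul_div_assoc', div_le_iff₀ (by positivity)]
    linarith
  · rw [mul_div_assoc', le_div_iff₀ (by positivity)]
    linarith

/-- Overlap of the two annuli forces `9/32 ≤ 2^i ≤ 32/9`, strictly between `2^{-2}` and `2^2`. -/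
theorem IsLittlewoodPaley.schwartzBlock_kernel_eq_zero (hφ : IsLittlewoodPaley φ) {i : ℤ}
    (hi : i ∉ Finset.Icc (-1 : ℤ) 1) : schwartzBlock φ i hφ.kernel = 0 := by
  refine schwartz_ext_fourier fun ξ => ?_
  rw [hφ.fourier_schwartzBlock, FourierTransform.fourier_zero, hφ.fourier_kernel, hφ.symbol_apply]
  by_contra hne
  rw [zero_apply] at hne
  obtain ⟨h1, h2⟩ := hφ.norm_mem (by exact_mod_cast right_ne_zero_of_mul hne)
  obtain ⟨h3, h4⟩ := hφ.norm_mem (by exact_mod_cast left_ne_zero_of_mul hne)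
  have h2k : (0 : ℝ) < 2 ^ i := by positivity
  rw [norm_smul _ ((2 * Real.pi) • ξ), Real.norm_of_nonneg (by positivity), zpow_neg,
    inv_mul_eq_div] at h3 h4
  rw [le_div_iff₀ h2k] at h3
  rw [div_le_iff₀ h2k] at h4
  have hlow : (2 : ℝ) ^ (-2 : ℤ) < 2 ^ i := by
    norm_num
    linarith
  have hhigh : (2 : ℝ) ^ i < 2 ^ (2 : ℤ) := by
    norm_num
    linarith
  rw [zpow_lt_zpow_iff_right₀ one_lt_two] at hlow hhigh
  exact hi (Finset.mem_Icc.mpr ⟨by omega, by omega⟩)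

/-- The case `n = 1` gives `h 0 > 0`; the case `n = 3` gives the nonzero pairing in the lower bound.
In positive dimension there is some `ξ ≠ 0`, where the partition of unity prevents `φ` from
vanishing at every scale. -/
theorem IsLittlewoodPaley.integral_pow_pos (hd : 1 ≤ d) (hφ : IsLittlewoodPaley φ) (n : ℕ)
    (hn : n ≠ 0) : 0 < ∫ ξ, φ ((2 * Real.pi) • ξ) ^ n := by
  have : Nonempty (Fin d) := ⟨⟨0, hd⟩⟩
  obtain ⟨ξ₀, hξ₀⟩ := exists_ne (0 : EuclideanSpace ℝ (Fin d))
  obtain ⟨j, hj⟩ : ∃ j : ℤ, φ ((2 : ℝ) ^ (-j) • ξ₀) ≠ 0 := by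
    by_contra! hcon
    have := hφ.hasSum ξ₀ hξ₀
    simp only [hcon] at this
    exact zero_ne_one (hasSum_zero.unique this)
  have hcont : Continuous fun ξ => φ ((2 * Real.pi) • ξ) ^ n :=
    (hφ.contDiff.continuous.comp (by fun_prop)).pow n
  have hcs : HasCompactSupport fun ξ => φ ((2 * Real.pi) • ξ) ^ n :=
    (hφ.hasCompactSupport.comp_smul (c := 2 * Real.pi) (by positivity)).comp_left
      (g := fun x : ℝ => x ^ n) (zero_pow hn)
  refine hcont.integral_pos_of_hasCompactSupport_nonneg_nonzero hcs
    (fun ξ => pow_nonneg (hφ.mem_Icc _).1 n)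
    (x := (2 * Real.pi)⁻¹ • (2 : ℝ) ^ (-j) • ξ₀) ?_
  rw [smul_inv_smul₀ (by positivity)]
  exact pow_ne_zero n hj

theorem IsLittlewoodPaley.kernel_zero (hφ : IsLittlewoodPaley φ) :
    hφ.kernel 0 = ((∫ ξ, φ ((2 * Real.pi) • ξ) : ℝ) : ℂ) := by
  rw [kernel, SchwartzMap.fourierInv_coe, Real.fourierInv_eq]
  simp [hφ.symbol_apply, integral_complex_ofReal]

end Kernel

/-! ### Upper bound for lacunary sums, lower bound for products -/

section Bounds

variable {d : ℕ} {φ : EuclideanSpace ℝ (Fin d) → ℝ}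

open scoped Pointwise in
/-- Upper bound for lacunary sums of dilates of the Littlewood-Paley kernel. -/
theorem IsLittlewoodPaley.besovNorm_sum_dyadicDilation_le (hφ : IsLittlewoodPaley φ)
    (p q : ℝ≥0∞) [Fact (1 ≤ p)] :
    ∃ B : ℝ, 0 < B ∧ ∀ (c : ℂ) (S : Finset ℤ),
      besovNorm φ (critExp d p) p q
        ((c • ∑ j ∈ S, dyadicDilation j hφ.kernel : 𝓢(EuclideanSpace ℝ (Fin d), ℂ)) :
          𝓢'(EuclideanSpace ℝ (Fin d), ℂ)) ≤
        ENNReal.ofReal (‖c‖ * B * (S.card : ℝ) ^ (q⁻¹).toReal) := by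
  set s := critExp d p with hs
  set b : ℤ → ℝ≥0∞ := fun i => ENNReal.ofReal ((2 : ℝ) ^ ((i : ℝ) * s)) *
    eLpNorm (schwartzBlock φ i hφ.kernel) p volume with hb
  have hbtop : ∑' i, b i ≠ ⊤ := by
    rw [tsum_eq_sum (s := Finset.Icc (-1 : ℤ) 1) fun i hi => by
      have hz : eLpNorm (0 : EuclideanSpace ℝ (Fin d) → ℂ) p volume = 0 := eLpNorm_zero
      simp [hb, hφ.schwartzBlock_kernel_eq_zero hi]]
    exact (ENNReal.sum_lt_top.mpr fun k _ => ENNReal.mul_lt_top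
      ENNReal.ofReal_lt_top (SchwartzMap.eLpNorm_lt_top _ _ _)).ne
  -- The factor `3` counts the blocks `j - 1, j, j + 1` met by each dilate; the `+ 1` only secures
  -- positivity.
  refine ⟨((∑' i, b i).toReal + 1) * 3 ^ (q⁻¹).toReal, by positivity, fun c S => ?_⟩
  have hblock : ∀ k : ℤ, schwartzBlock φ k (c • ∑ j ∈ S, dyadicDilation j hφ.kernel) =
      c • ∑ j ∈ S, dyadicDilation j (schwartzBlock φ (k - j) hφ.kernel) := fun k => by
    simp only [map_smul, map_sum, hφ.schwartzBlock_dyadicDilation]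
  have hzero : ∀ k ∉ S + Finset.Icc (-1 : ℤ) 1,
      schwartzBlock φ k (c • ∑ j ∈ S, dyadicDilation j hφ.kernel) = 0 := fun k hk => by
    rw [hblock, Finset.sum_eq_zero, smul_zero]
    intro j hj
    rw [hφ.schwartzBlock_kernel_eq_zero, map_zero]
    intro hkj
    exact hk (Finset.mem_add.mpr ⟨j, hj, k - j, hkj, by ring⟩)
  have hle : ∀ k : ℤ, ENNReal.ofReal ((2 : ℝ) ^ ((k : ℝ) * s)) *
      eLpNorm (schwartzBlock φ k (c • ∑ j ∈ S, dyadicDilation j hφ.kernel)) p volume ≤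
        ‖c‖ₑ * ∑' i, b i := fun k => by
    rw [hblock]
    have hcoe : ⇑(c • ∑ j ∈ S, dyadicDilation j (schwartzBlock φ (k - j) hφ.kernel)) =
        c • ∑ j ∈ S, ⇑(dyadicDilation j (schwartzBlock φ (k - j) hφ.kernel)) := by
      ext x
      simp [Finset.sum_apply]
    rw [hcoe, eLpNorm_const_smul, mul_left_comm]
    gcongr
    refine (mul_le_mul_right (eLpNorm_sum_le (fun j _ =>
      (SchwartzMap.continuous _).aestronglyMeasurable) Fact.out) _).trans ?_
    rw [Finset.mul_sum]
    -- By scale invariance the `j`-th term is `b (k - j)`, so the sum over `j` is bounded by `∑' i,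
    -- b i` uniformly in `k` and `S`.
    refine le_trans (Finset.sum_le_sum (g := fun j => b (k - j)) fun j _ => le_of_eq ?_)
      ((ENNReal.sum_le_tsum S).trans
        (ENNReal.tsum_comp_le_tsum_of_injective (sub_right_injective (b := k)) b))
    rw [eLpNorm_dyadicDilation, ← hs, ← mul_assoc, ← ENNReal.ofReal_mul (by positivity),
      ← Real.rpow_add two_pos, hb]
    congr 3
    push_cast
    ring_nf
  refine (hφ.besovNorm_le hzero fun k _ => hle k).trans ?_
  have hcard : ((S + Finset.Icc (-1 : ℤ) 1).card : ℝ) ≤ 3 * S.card := by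
    have := Finset.card_add_le (s := S) (t := Finset.Icc (-1 : ℤ) 1)
    simp only [Int.card_Icc] at this
    norm_num at this
    exact_mod_cast (mul_comm S.card 3 ▸ this)
  rw [← ENNReal.ofReal_natCast, ENNReal.ofReal_rpow_of_nonneg (by positivity)
    ENNReal.toReal_nonneg, ← ofReal_norm]
  conv_lhs => rw [← ENNReal.ofReal_toReal hbtop]
  rw [← ENNReal.ofReal_mul (by positivity), ← ENNReal.ofReal_mul (by positivity)]
  refine ENNReal.ofReal_le_ofReal ?_
  calc ‖c‖ * (∑' i, b i).toReal * ((S + Finset.Icc (-1 : ℤ) 1).card : ℝ) ^ (q⁻¹).toReal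
      ≤ ‖c‖ * ((∑' i, b i).toReal + 1) * (3 * (S.card : ℝ)) ^ (q⁻¹).toReal := by
        gcongr
        linarith
    _ = _ := by
        rw [Real.mul_rpow (by norm_num) (by positivity)]
        ring

/-- Hölder's inequality; in `ℝ≥0∞` the exponent `(1 - p⁻¹)⁻¹` is the conjugate of `p`, endpoints
included. -/
theorem enorm_integral_mul_le (p : ℝ≥0∞) [Fact (1 ≤ p)]
    (u v : 𝓢(EuclideanSpace ℝ (Fin d), ℂ)) :
    ‖∫ x, u x * v x‖ₑ ≤ eLpNorm u (1 - p⁻¹)⁻¹ volume * eLpNorm v p volume := by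
  have := ENNReal.HolderConjugate.inv_one_sub_inv' (a := p) Fact.out
  have : (1 - p⁻¹)⁻¹.HolderTriple p 1 := this.symm
  refine (enorm_integral_le_lintegral_enorm _).trans ?_
  rw [← eLpNorm_one_eq_lintegral_enorm]
  exact eLpNorm_smul_le_mul_eLpNorm (φ := u) (f := v) v.continuous.aestronglyMeasurable
    u.continuous.aestronglyMeasurable

/-- Passing `𝓕` across the pairing turns the block into multiplication by the symbol, which is then
absorbed into the test function. -/
theorem IsLittlewoodPaley.integral_fourier_symbol_mul_schwartzBlock (hφ : IsLittlewoodPaley φ)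
    (v : 𝓢(EuclideanSpace ℝ (Fin d), ℂ)) :
    ∫ x, 𝓕 hφ.symbol x * schwartzBlock φ 0 v x =
      ∫ x, 𝓕 (schwartzMul hφ.symbol hφ.symbol) x * v x := by
  rw [SchwartzMap.integral_fourier_mul_eq, SchwartzMap.integral_fourier_mul_eq]
  congr 1
  ext ξ
  rw [hφ.fourier_schwartzBlock, schwartzMul_apply, hφ.symbol_apply]
  simp [mul_assoc]

theorem IsLittlewoodPaley.integral_fourier_mul_kernel (hφ : IsLittlewoodPaley φ) :
    ∫ x, 𝓕 (schwartzMul hφ.symbol hφ.symbol) x * hφ.kernel x =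
      ((∫ ξ, φ ((2 * Real.pi) • ξ) ^ 3 : ℝ) : ℂ) := by
  rw [SchwartzMap.integral_fourier_mul_eq, hφ.fourier_kernel, ← integral_complex_ofReal]
  congr 1
  ext ξ
  rw [schwartzMul_apply, hφ.symbol_apply]
  push_cast
  ring

/-- Testing a Schwartz function against its slow dilates picks out the value at the origin. -/
theorem tendsto_integral_mul_dyadicDilation (κ F h : 𝓢(EuclideanSpace ℝ (Fin d), ℂ)) :
    Tendsto (fun M : ℕ => ∫ x, κ x * schwartzMul (dyadicDilation (-M) F) h x) atTop
      (𝓝 (F 0 * ∫ x, κ x * h x)) := by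
  rw [← integral_const_mul]
  refine tendsto_integral_of_dominated_convergence
    (fun x => SchwartzMap.seminorm ℝ 0 0 F * ‖schwartzMul κ h x‖)
    (fun M => ((SchwartzMap.continuous _).mul (SchwartzMap.continuous _)).aestronglyMeasurable)
    ((schwartzMul κ h).integrable.norm.const_mul _) (fun M => ?_) ?_
  · refine Eventually.of_forall fun x => ?_
    rw [schwartzMul_apply, schwartzMul_apply, dyadicDilation_apply, norm_mul, norm_mul, norm_mul,
      mul_left_comm]
    gcongr
    exact SchwartzMap.norm_le_seminorm ℝ F _
  · refine Eventually.of_forall fun x => ?_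
    have h1 : Tendsto (fun M : ℕ => ((2 : ℝ) ^ (-(M : ℤ))) • x) atTop (𝓝 0) := by
      have h2 : Tendsto (fun M : ℕ => ((1 / 2 : ℝ) ^ M) • x) atTop (𝓝 ((0 : ℝ) • x)) :=
        (tendsto_pow_atTop_nhds_zero_of_lt_one (by norm_num) (by norm_num)).smul_const x
      simpa using h2
    have h3 := ((F.continuous.tendsto 0).comp h1).mul_const (κ x * h x)
    refine h3.congr fun M => ?_
    rw [schwartzMul_apply, dyadicDilation_apply, Function.comp_apply]
    ring

/-- Multiplying a band-limited function `F` by a sufficiently concentrated dilate of the kernel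
gives an element of the Besov space whose norm controls `|F 0|`. -/
theorem IsLittlewoodPaley.exists_le_besovNorm_schwartzMul (hd : 1 ≤ d) (hφ : IsLittlewoodPaley φ)
    (p : ℝ≥0∞) {q : ℝ≥0∞} [Fact (1 ≤ p)] (hq : q ≠ 0) :
    ∃ c : ℝ, 0 < c ∧ ∀ (F : 𝓢(EuclideanSpace ℝ (Fin d), ℂ)) (b : ℝ),
      (∀ ξ, 𝓕 F ξ ≠ 0 → ‖ξ‖ ≤ b) → ∃ M : ℤ,
        MemBesov φ (critExp d p) p q ((schwartzMul F (dyadicDilation M hφ.kernel) :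
          𝓢(EuclideanSpace ℝ (Fin d), ℂ)) : 𝓢'(EuclideanSpace ℝ (Fin d), ℂ)) ∧
        ENNReal.ofReal (c * ‖F 0‖) ≤
          besovNorm φ (critExp d p) p q ((schwartzMul F (dyadicDilation M hφ.kernel) :
            𝓢(EuclideanSpace ℝ (Fin d), ℂ)) : 𝓢'(EuclideanSpace ℝ (Fin d), ℂ)) := by
  set L := ∫ ξ, φ ((2 * Real.pi) • ξ) ^ 3 with hL
  have hLpos : 0 < L := hφ.integral_pow_pos hd 3 (by norm_num)
  set A := eLpNorm (𝓕 hφ.symbol : 𝓢(EuclideanSpace ℝ (Fin d), ℂ)) (1 - p⁻¹)⁻¹ volume with hA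
  have hAtop : A ≠ ⊤ := (SchwartzMap.eLpNorm_lt_top _ _ _).ne
  -- The `2` is lost by taking half of the limiting pairing `‖F 0‖ * L`; `A` is the Hölder cost,
  -- with `+ 1` to keep the denominator positive.
  refine ⟨L / (2 * (A.toReal + 1)), by positivity, fun F b hF => ?_⟩
  have hlim := (tendsto_integral_mul_dyadicDilation
    (𝓕 (schwartzMul hφ.symbol hφ.symbol)) F hφ.kernel).norm
  rw [hφ.integral_fourier_mul_kernel, norm_mul, Complex.norm_real,
    Real.norm_of_nonneg hLpos.le] at hlim
  have hev : ∀ᶠ M : ℕ in atTop, ‖F 0‖ * L / 2 ≤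
      ‖∫ x, 𝓕 (schwartzMul hφ.symbol hφ.symbol) x *
        schwartzMul (dyadicDilation (-M) F) hφ.kernel x‖ := by
    rcases eq_or_ne (F 0) 0 with h0 | h0
    · exact Eventually.of_forall fun M => by simp [h0]
    · refine (hlim.eventually (eventually_gt_nhds (half_lt_self ?_))).mono fun M h => h.le
      have := norm_pos_iff.mpr h0
      positivity
  -- The inner radius of the spectrum of the dilated kernel must exceed `b`, so that the product has
  -- no low frequencies and lies in the Besov space.
  have hbig : ∀ᶠ M : ℕ in atTop, b < (2 : ℝ) ^ M * (3 / (8 * Real.pi)) :=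
    ((tendsto_pow_atTop_atTop_of_one_lt one_lt_two).atTop_mul_const
      (by positivity)).eventually_gt_atTop b
  obtain ⟨M, hM1, hM2⟩ := (hev.and hbig).exists
  refine ⟨M, ?_, ?_⟩
  · rw [← zpow_natCast] at hM2
    exact hφ.memBesov _ p q (sub_pos.mpr hM2) (fourier_schwartzMul_support hF
      (hφ.fourier_dyadicDilation_kernel_support (M : ℤ)))
  · refine le_trans ?_ (hφ.le_besovNorm _ p hq _ M)
    -- Zooming in by `2^M` turns block `M` of the product into block `0` of `v`, at no cost in the
    -- critical norm.
    set v := schwartzMul (dyadicDilation (-M) F) hφ.kernel with hv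
    have hu : schwartzMul F (dyadicDilation M hφ.kernel) = dyadicDilation M v := by
      rw [hv, dyadicDilation_schwartzMul, dyadicDilation_dyadicDilation]
      congr 1
      ext x
      simp [dyadicDilation_apply]
    have hX : eLpNorm (schwartzBlock φ 0 v) p volume ≠ ⊤ :=
      (SchwartzMap.eLpNorm_lt_top _ _ _).ne
    rw [hu, hφ.schwartzBlock_dyadicDilation, eLpNorm_dyadicDilation, ← mul_assoc,
      ← ENNReal.ofReal_mul (by positivity), ← Real.rpow_add two_pos, sub_self, neg_mul,
      add_neg_cancel, Real.rpow_zero, ENNReal.ofReal_one, one_mul]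
    refine ENNReal.ofReal_le_of_le_toReal ?_
    have hH := enorm_integral_mul_le p (𝓕 hφ.symbol) (schwartzBlock φ 0 v)
    rw [hφ.integral_fourier_symbol_mul_schwartzBlock] at hH
    have hH2 := ENNReal.toReal_mono (ENNReal.mul_ne_top hAtop hX) hH
    rw [toReal_enorm, ENNReal.toReal_mul] at hH2
    have hH3 := hM1.trans hH2
    rw [div_mul_eq_mul_div, div_le_iff₀ (by positivity)]
    have := ENNReal.toReal_nonneg (a := eLpNorm (schwartzBlock φ 0 v) p volume)
    nlinarith

end Bounds

/-! ### Growth of the iterated logarithm -/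

section Growth

/-- The threshold is `3` because `3 > e`. -/
theorem log_log_pos {N : ℕ} (hN : 3 ≤ N) : 0 < Real.log (Real.log N) := by
  have h3 : (3 : ℝ) ≤ N := by exact_mod_cast hN
  refine Real.log_pos ((Real.lt_log_iff_exp_lt (by linarith)).mpr ?_)
  linarith [Real.exp_one_lt_d9]

theorem log_log_le_rpow_div {N : ℕ} (hN : 3 ≤ N) {ε : ℝ} (hε : 0 < ε) :
    Real.log (Real.log N) ≤ (N : ℝ) ^ ε / ε := by
  have h3 : (3 : ℝ) ≤ N := by exact_mod_cast hN
  exact (Real.log_le_self (Real.log_nonneg (by linarith))).trans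
    (Real.log_le_rpow_div (by positivity) hε)

theorem rpow_neg_le_inv_log_log {N : ℕ} (hN : 3 ≤ N) {ε : ℝ} (hε : 0 < ε) :
    (N : ℝ) ^ (-ε) ≤ ε⁻¹ * (Real.log (Real.log N))⁻¹ := by
  have hl := log_log_pos hN
  have hNpos : (0 : ℝ) < N := by exact_mod_cast (by omega : 0 < N)
  have h := log_log_le_rpow_div hN hε
  rw [le_div_iff₀ hε] at h
  rw [Real.rpow_neg hNpos.le, ← mul_inv]
  exact inv_anti₀ (by positivity) (by linarith)

theorem tendsto_inv_log_log :
    Tendsto (fun N : ℕ => (Real.log (Real.log N))⁻¹) atTop (𝓝 0) :=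
  tendsto_inv_atTop_zero.comp (Real.tendsto_log_atTop.comp
    (Real.tendsto_log_atTop.comp tendsto_natCast_atTop_atTop))

theorem tendsto_rpow_mul_inv_log_log {β : ℝ} (hβ : 0 < β) :
    Tendsto (fun N : ℕ => (N : ℝ) ^ β * (Real.log (Real.log N))⁻¹) atTop atTop := by
  -- Half of the power absorbs the logarithm and the other half still diverges.
  have hb : 0 < β / 2 := by positivity
  have h1 : Tendsto (fun N : ℕ => β / 2 * (N : ℝ) ^ (β / 2)) atTop atTop :=
    ((tendsto_rpow_atTop hb).comp tendsto_natCast_atTop_atTop).const_mul_atTop hb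
  refine tendsto_atTop_mono' atTop ?_ h1
  filter_upwards [eventually_ge_atTop 3] with N hN
  have hl := log_log_pos hN
  have hNpos : (0 : ℝ) < N := by exact_mod_cast (by omega : 0 < N)
  have h := log_log_le_rpow_div hN hb
  rw [le_div_iff₀ hb] at h
  rw [← div_eq_mul_inv, le_div_iff₀ hl]
  calc β / 2 * (N : ℝ) ^ (β / 2) * Real.log (Real.log N)
      = (N : ℝ) ^ (β / 2) * (Real.log (Real.log N) * (β / 2)) := by ring
    _ ≤ (N : ℝ) ^ (β / 2) * (N : ℝ) ^ (β / 2) := by gcongr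
    _ = (N : ℝ) ^ β := by rw [← Real.rpow_add hNpos, add_halves]

end Growth

/-! ### The counterexample and the main theorem -/

section Counterexample

variable {d : ℕ} {φ : EuclideanSpace ℝ (Fin d) → ℝ}

theorem IsLittlewoodPaley.fourier_sum_dyadicDilation_support (hφ : IsLittlewoodPaley φ) (c : ℂ)
    (a b : ℤ) (S : Finset ℤ) (hS : ∀ j ∈ S, a ≤ j ∧ j ≤ b) (ξ : EuclideanSpace ℝ (Fin d))
    (h : 𝓕 (c • ∑ j ∈ S, dyadicDilation j hφ.kernel) ξ ≠ 0) :
    (2 : ℝ) ^ a * (3 / (8 * Real.pi)) ≤ ‖ξ‖ ∧ ‖ξ‖ ≤ (2 : ℝ) ^ b * (4 / (3 * Real.pi)) := by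
  have hF : 𝓕 (c • ∑ j ∈ S, dyadicDilation j hφ.kernel) =
      c • ∑ j ∈ S, 𝓕 (dyadicDilation j hφ.kernel) := by
    simp only [← FourierTransform.fourierCLM_apply (R := ℂ), map_smul, map_sum]
  obtain ⟨j, hj, hne⟩ : ∃ j ∈ S, 𝓕 (dyadicDilation j hφ.kernel) ξ ≠ 0 := by
    by_contra! hcon
    refine h ?_
    rw [hF]
    simp [Finset.sum_eq_zero hcon]
  obtain ⟨h1, h2⟩ := hφ.fourier_dyadicDilation_kernel_support j ξ hne
  obtain ⟨haj, hjb⟩ := hS j hj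
  refine ⟨le_trans ?_ h1, h2.trans ?_⟩
  · gcongr
    norm_num
  · gcongr
    norm_num

theorem IsLittlewoodPaley.exists_log_log_counterexample (hd : 1 ≤ d) (hφ : IsLittlewoodPaley φ)
    (p : ℝ≥0∞) {q : ℝ≥0∞} [Fact (1 ≤ p)] (hq : q ≠ 0) {α : ℝ} (hα : (q⁻¹).toReal < α) :
    ∃ f g : ℕ → 𝓢(EuclideanSpace ℝ (Fin d), ℂ), ∃ (C c : ℝ) (N₀ : ℕ),
      0 < C ∧ 0 < c ∧ 0 < Real.log (Real.log N₀) ∧ ∀ N : ℕ, N₀ ≤ N →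
        MemBesov φ (critExp d p) p q (f N) ∧
        MemBesov φ (critExp d p) p q (g N) ∧
        MemBesov φ (critExp d p) p q (schwartzMul (f N) (g N)) ∧
        besovNorm φ (critExp d p) p q (f N) + besovNorm φ (critExp d p) p q (g N) ≤
          ENNReal.ofReal (C * (Real.log (Real.log N))⁻¹) ∧
        ENNReal.ofReal (c * (N : ℝ) ^ (1 - α) * (Real.log (Real.log N))⁻¹) ≤
          besovNorm φ (critExp d p) p q (schwartzMul (f N) (g N)) := by
  obtain ⟨B, hB, hupper⟩ := hφ.besovNorm_sum_dyadicDilation_le p q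
  obtain ⟨c, hc, hlower⟩ := hφ.exists_le_besovNorm_schwartzMul hd p hq
  set κ := ∫ ξ, φ ((2 * Real.pi) • ξ) with hκ
  have hκpos : 0 < κ := by simpa using hφ.integral_pow_pos hd 1 one_ne_zero
  set S : ℕ → Finset ℤ := fun N => Finset.Ico 0 (N : ℤ) with hS
  have hSmem : ∀ N, ∀ j ∈ S N, (0 : ℤ) ≤ j ∧ j ≤ N := fun N j hj =>
    ⟨(Finset.mem_Ico.mp hj).1, (Finset.mem_Ico.mp hj).2.le⟩
  set l : ℕ → ℝ := fun N => (Real.log (Real.log N))⁻¹ with hl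
  set f : ℕ → 𝓢(EuclideanSpace ℝ (Fin d), ℂ) := fun N =>
    (((N : ℝ) ^ (-α) : ℝ) : ℂ) • ∑ j ∈ S N, dyadicDilation j hφ.kernel with hf
  have hlf : ∀ N, ((l N : ℝ) : ℂ) • f N = (((l N * (N : ℝ) ^ (-α)) : ℝ) : ℂ) •
      ∑ j ∈ S N, dyadicDilation j hφ.kernel := fun N => by
    rw [hf, smul_smul, ← Complex.ofReal_mul]
  -- The scale of `g N` is chosen after `f N`. The factor `l N` is put on `f N` here and moved to `g
  -- N` by bilinearity.
  choose M hM1 hM2 using fun N => hlower (((l N : ℝ) : ℂ) • f N)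
    ((2 : ℝ) ^ (N : ℤ) * (4 / (3 * Real.pi))) fun ξ hξ => by
      rw [hlf] at hξ
      exact (hφ.fourier_sum_dyadicDilation_support _ 0 N (S N) (hSmem N) ξ hξ).2
  -- Writing `g N` as a sum over a singleton lets the upper bound and the support lemma for `f N`
  -- apply to it as well.
  set g : ℕ → 𝓢(EuclideanSpace ℝ (Fin d), ℂ) := fun N =>
    ((l N : ℝ) : ℂ) • ∑ j ∈ ({M N} : Finset ℤ), dyadicDilation j hφ.kernel with hg
  have hfg : ∀ N, schwartzMul (f N) (g N) =
      schwartzMul (((l N : ℝ) : ℂ) • f N) (dyadicDilation (M N) hφ.kernel) := fun N => by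
    simp only [hg, Finset.sum_singleton, schwartzMul_smul]
  have hf0 : ∀ N, 3 ≤ N → ‖(((l N : ℝ) : ℂ) • f N) 0‖ = κ * (N : ℝ) ^ (1 - α) * l N :=
      fun N hN => by
    have hNpos : (0 : ℝ) < N := by exact_mod_cast (by omega : 0 < N)
    have hlpos : 0 < l N := inv_pos.mpr (log_log_pos hN)
    have hsum : (∑ j ∈ S N, dyadicDilation j hφ.kernel) 0 = (N : ℂ) * (κ : ℂ) := by
      simp [dyadicDilation_apply, hφ.kernel_zero, hS, hκ]
    rw [hlf, smul_apply, hsum, smul_eq_mul, norm_mul, norm_mul, Complex.norm_real,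
      Complex.norm_real, Complex.norm_natCast, Real.norm_of_nonneg (by positivity),
      Real.norm_of_nonneg hκpos.le, sub_eq_add_neg, Real.rpow_add hNpos, Real.rpow_one]
    ring
  set ε := α - (q⁻¹).toReal with hε
  have hεpos : 0 < ε := sub_pos.mpr hα
  refine ⟨f, g, B * ε⁻¹ + B, c * κ, 3, by positivity, by positivity,
    by exact_mod_cast log_log_pos le_rfl, fun N hN => ⟨?_, ?_, ?_, ?_, ?_⟩⟩
  · exact hφ.memBesov _ p q (by positivity)
      (hφ.fourier_sum_dyadicDilation_support _ 0 N (S N) (hSmem N))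
  · exact hφ.memBesov _ p q (by positivity)
      (hφ.fourier_sum_dyadicDilation_support _ (M N) (M N) {M N} (by simp))
  · rw [hfg]
    exact hM1 N
  · have hNpos : (0 : ℝ) < N := by exact_mod_cast (by omega : 0 < N)
    have hlpos : 0 < l N := inv_pos.mpr (log_log_pos hN)
    have h1 := hupper (((N : ℝ) ^ (-α) : ℝ) : ℂ) (S N)
    have h2 := hupper ((l N : ℝ) : ℂ) {M N}
    refine (add_le_add h1 h2).trans ?_
    rw [← ENNReal.ofReal_add (by positivity) (by positivity)]
    refine ENNReal.ofReal_le_ofReal ?_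
    have hcard : ((S N).card : ℝ) = N := by simp [hS]
    -- The left side is `N^{-ε}`: a negative power beats `(ln ln N)⁻¹`, so the norm of `g N` sets
    -- the rate.
    have h3 : (N : ℝ) ^ (-α) * (N : ℝ) ^ (q⁻¹).toReal ≤ ε⁻¹ * l N := by
      rw [← Real.rpow_add hNpos, show -α + (q⁻¹).toReal = -ε by rw [hε]; ring]
      exact rpow_neg_le_inv_log_log hN hεpos
    rw [hcard, Complex.norm_real, Complex.norm_real, Real.norm_of_nonneg (by positivity),
      Real.norm_of_nonneg hlpos.le, Finset.card_singleton, Nat.cast_one, Real.one_rpow]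
    calc _ = B * ((N : ℝ) ^ (-α) * (N : ℝ) ^ (q⁻¹).toReal) + B * l N := by ring
      _ ≤ B * (ε⁻¹ * l N) + B * l N := by gcongr
      _ = _ := by ring
  · rw [hfg]
    refine le_trans (le_of_eq ?_) (hM2 N)
    rw [hf0 N hN]
    simp only [hl]
    ring_nf

end Counterexample

theorem mainTheorem4 (d : ℕ) (hd : 1 ≤ d)
    (φ : EuclideanSpace ℝ (Fin d) → ℝ) (hφ : IsLittlewoodPaley φ)
    (p q : ℝ≥0∞) [Fact (1 ≤ p)] (hq : 1 < q) :
    (∀ α : ℝ, (q⁻¹).toReal < α → α < 1 →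
      ∃ f g : ℕ → 𝓢(EuclideanSpace ℝ (Fin d), ℂ),
        (∃ (C c : ℝ) (N₀ : ℕ), 0 < C ∧ 0 < c ∧ 0 < Real.log (Real.log N₀) ∧ ∀ N : ℕ, N₀ ≤ N →
          MemBesov φ (critExp d p) p q (f N) ∧
          MemBesov φ (critExp d p) p q (g N) ∧
          MemBesov φ (critExp d p) p q (schwartzMul (f N) (g N)) ∧
          besovNorm φ (critExp d p) p q (f N) + besovNorm φ (critExp d p) p q (g N) ≤
            ENNReal.ofReal (C * (Real.log (Real.log N))⁻¹) ∧
          ENNReal.ofReal (c * (N : ℝ) ^ (1 - α) * (Real.log (Real.log N))⁻¹) ≤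
            besovNorm φ (critExp d p) p q (schwartzMul (f N) (g N))) ∧
        Tendsto (fun N => besovNorm φ (critExp d p) p q (f N) +
          besovNorm φ (critExp d p) p q (g N)) atTop (𝓝 0) ∧
        Tendsto (fun N => besovNorm φ (critExp d p) p q (schwartzMul (f N) (g N)))
          atTop (𝓝 ⊤)) ∧
    ∀ C : ℝ, ∃ f g : 𝓢(EuclideanSpace ℝ (Fin d), ℂ),
      MemBesov φ (critExp d p) p q f ∧ MemBesov φ (critExp d p) p q g ∧
      MemBesov φ (critExp d p) p q (schwartzMul f g) ∧
      ENNReal.ofReal C * besovNorm φ (critExp d p) p q f * besovNorm φ (critExp d p) p q g <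
        besovNorm φ (critExp d p) p q (schwartzMul f g) := by
  have hq0 : q ≠ 0 := (zero_lt_one.trans hq).ne'
  have main : ∀ α : ℝ, (q⁻¹).toReal < α → α < 1 →
      ∃ f g : ℕ → 𝓢(EuclideanSpace ℝ (Fin d), ℂ),
        (∃ (C c : ℝ) (N₀ : ℕ), 0 < C ∧ 0 < c ∧ 0 < Real.log (Real.log N₀) ∧ ∀ N : ℕ, N₀ ≤ N →
          MemBesov φ (critExp d p) p q (f N) ∧
          MemBesov φ (critExp d p) p q (g N) ∧
          MemBesov φ (critExp d p) p q (schwartzMul (f N) (g N)) ∧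
          besovNorm φ (critExp d p) p q (f N) + besovNorm φ (critExp d p) p q (g N) ≤
            ENNReal.ofReal (C * (Real.log (Real.log N))⁻¹) ∧
          ENNReal.ofReal (c * (N : ℝ) ^ (1 - α) * (Real.log (Real.log N))⁻¹) ≤
            besovNorm φ (critExp d p) p q (schwartzMul (f N) (g N))) ∧
        Tendsto (fun N => besovNorm φ (critExp d p) p q (f N) +
          besovNorm φ (critExp d p) p q (g N)) atTop (𝓝 0) ∧
        Tendsto (fun N => besovNorm φ (critExp d p) p q (schwartzMul (f N) (g N)))
          atTop (𝓝 ⊤) := by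
    intro α hα hα1
    obtain ⟨f, g, C, c, N₀, hC, hc, hN₀, h⟩ := hφ.exists_log_log_counterexample hd p hq0 hα
    refine ⟨f, g, ⟨C, c, N₀, hC, hc, hN₀, h⟩, ?_, ?_⟩
    · have h1 : Tendsto (fun N : ℕ => ENNReal.ofReal (C * (Real.log (Real.log N))⁻¹)) atTop
          (𝓝 0) := by
        simpa using ENNReal.tendsto_ofReal (tendsto_inv_log_log.const_mul C)
      refine tendsto_of_tendsto_of_tendsto_of_le_of_le' tendsto_const_nhds h1
        (Eventually.of_forall fun _ => zero_le) ?_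
      filter_upwards [eventually_ge_atTop N₀] with N hN using (h N hN).2.2.2.1
    · have h1 : Tendsto (fun N : ℕ =>
          ENNReal.ofReal (c * (N : ℝ) ^ (1 - α) * (Real.log (Real.log N))⁻¹)) atTop (𝓝 ⊤) := by
        refine ENNReal.tendsto_ofReal_atTop.comp ?_
        simp only [mul_assoc]
        exact (tendsto_rpow_mul_inv_log_log (sub_pos.mpr hα1)).const_mul_atTop hc
      refine tendsto_of_tendsto_of_tendsto_of_le_of_le' h1 tendsto_const_nhds ?_
        (Eventually.of_forall fun _ => le_top)
      filter_upwards [eventually_ge_atTop N₀] with N hN using (h N hN).2.2.2.2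
  refine ⟨main, fun C => ?_⟩
  have hq1 : (q⁻¹).toReal < 1 := by
    rw [← ENNReal.toReal_one]
    exact (ENNReal.toReal_lt_toReal (by simpa using hq0) (by simp)).mpr (ENNReal.inv_lt_one.mpr hq)
  obtain ⟨α, hα, hα1⟩ := exists_between hq1
  obtain ⟨f, g, ⟨_, _, N₀, -, -, -, h⟩, hlim0, hlimtop⟩ := main α hα hα1
  -- The product of the two norms is at most the square of their sum, which tends to `0`; the norm
  -- of `f g` eventually exceeds `1`.
  have hsmall : Tendsto (fun N => ENNReal.ofReal C * (besovNorm φ (critExp d p) p q (f N) +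
      besovNorm φ (critExp d p) p q (g N)) * (besovNorm φ (critExp d p) p q (f N) +
      besovNorm φ (critExp d p) p q (g N))) atTop (𝓝 0) := by
    have h1 := ENNReal.Tendsto.const_mul (a := ENNReal.ofReal C) hlim0
      (Or.inr ENNReal.ofReal_ne_top)
    simpa using ENNReal.Tendsto.mul h1 (Or.inr ENNReal.zero_ne_top) hlim0 (Or.inr (by simp))
  obtain ⟨N, hN, h1, h2⟩ := ((eventually_ge_atTop N₀).and
    ((hsmall.eventually_lt_const zero_lt_one).and
      (hlimtop.eventually_const_lt ENNReal.one_lt_top))).exists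
  obtain ⟨hf, hg, hfg, -, -⟩ := h N hN
  refine ⟨f N, g N, hf, hg, hfg, lt_of_le_of_lt ?_ (h1.trans h2)⟩
  gcongr
  · exact le_self_add
  · exact le_add_self
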